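/- A (finite abstract) simplicial complex is a finite collection of finite sets (faces) closed under taking subsets; its vertices are the points $v$ such that $\{v\}$ is a face, its facets are the inclusion-maximal faces, a face $F$ has dimension $|F|-1$, and the dimension of the complex is the largest dimension of a face. For a subset $U$ of the vertex set $V$ of a complex $K$, the subcomplex of $K$ induced by $U$ consists of the faces of $K$ contained in $U$; it is proper if $U\subsetneq V$. A complex is (nonpure) shellable if its facets can be arranged in an order $F_1,\dots,F_t$ such that for every $2\le k\le t$ the complex $\big(\overline{F_1}\cup\dots\cup\overline{F_{k-1}}\big)\cap\overline{F_k}$ is pure of dimension $\dim F_k-1$, that is, all its maximal faces have exactly $|F_k|-1$ elements; here $\overline{F}$ denotes the set of all subsets of $F$ (including $\emptyset$). An obstruction to shellability is a nonshellable simplicial complex all of whose proper induced subcomplexes are shellable. **Theorem 3.** There are no $2$-dimensional obstructions to shellability with more than $7$ vertices. That is, every $2$-dimensional simplicial complex with more than $7$ vertices all of whose proper induced subcomplexes are shellable is itself shellable. -/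

import Mathlib

namespace PreAbstractSimplicialComplex

variable {α : Type*}

/-- The vertex set of `K`: the points `v` such that `{v}` is a face. -/
def vertices (K : PreAbstractSimplicialComplex α) : Set α :=
  {v | {v} ∈ K}

/-- The subcomplex `K(U)` of `K` induced by `U`: the faces of `K` all of whose vertices lie
in `U`. -/
def induced (K : PreAbstractSimplicialComplex α) (U : Set α) :
    PreAbstractSimplicialComplex α where
  faces := {s | s ∈ K ∧ (s : Set α) ⊆ U}
  isRelLowerSet_faces := fun _ hs =>
    ⟨(K.isRelLowerSet_faces hs.1).1, fun _ hts ht =>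
      ⟨(K.isRelLowerSet_faces hs.1).2 hts ht, (Finset.coe_subset.mpr hts).trans hs.2⟩⟩

/-- `K` has dimension `d`: the largest faces of `K` have `d + 1` vertices. -/
def HasDimension (K : PreAbstractSimplicialComplex α) (d : ℕ) : Prop :=
  (∃ s ∈ K, s.card = d + 1) ∧ ∀ s ∈ K, s.card ≤ d + 1

/-- A facet of `K` is a face that is maximal under inclusion. -/
def IsFacet (K : PreAbstractSimplicialComplex α) (F : Finset α) : Prop :=
  Maximal (fun s => s ∈ K) F

/-- The faces of `(F̄₁ ∪ ⋯ ∪ F̄ₘ) ∩ F̄`, where `l` lists `F₁, …, Fₘ` and `F̄` is the simplex of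
all subsets of `F`. The empty face is included. -/
def previousFaces (l : List (Finset α)) (F : Finset α) : Set (Finset α) :=
  {G | G ⊆ F ∧ ∃ E ∈ l, G ⊆ E}

/-- The list `l` is a (nonpure) shelling of `K`: it lists every facet of `K` exactly once, and
for every facet `F` in the list but the first, the intersection of the simplex `F̄` with the
complex generated by the facets before `F` is pure of dimension `dim F - 1`, that is, all its
maximal faces have exactly one vertex less than `F`. -/
def IsShelling (K : PreAbstractSimplicialComplex α) (l : List (Finset α)) : Prop :=
  l.Nodup ∧ (∀ F, F ∈ l ↔ K.IsFacet F) ∧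
    ∀ (l₁ : List (Finset α)) (F : Finset α) (l₂ : List (Finset α)),
      l = l₁ ++ F :: l₂ → l₁ ≠ [] →
        ∀ G, Maximal (fun s => s ∈ previousFaces l₁ F) G → G.card + 1 = F.card

/-- `K` is (nonpure) shellable: its facets can be arranged in a shelling. -/
def Shellable (K : PreAbstractSimplicialComplex α) : Prop :=
  ∃ l : List (Finset α), K.IsShelling l

/-- An obstruction to shellability: a nonshellable complex all of whose proper induced
subcomplexes are shellable. -/
def IsObstruction (K : PreAbstractSimplicialComplex α) : Prop :=
  ¬ K.Shellable ∧ ∀ U : Set α, U ⊂ K.vertices → (K.induced U).Shellable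

end PreAbstractSimplicialComplex

namespace PreAbstractSimplicialComplex

variable {α : Type*}

/-! Shell the triangles first, then add the facets of lower dimension.

For the triangles, choose a vertex `v` missed by some triangle. The triangles avoiding `v` are
shelled, since they come from a proper induced subcomplex. Next come the triangles at `v` whose
opposite edge is already present (`boundStar`), then the other triangles at `v`. Each new triangle
must never meet the earlier ones in an isolated vertex, and this reduces to connectivity: of the
family, of its vertex stars, and of the part of the link of `v` lying in the complex of the
triangles avoiding `v`. Connectivity is used in cut form: whenever a predicate `P` separates two
members, it separates two members sharing an edge. A failure is thus witnessed by two triangles and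
seen in a restriction to few vertices.

Connectivity of the family and of stars passes along a shelling (`Shelled.exists_adjacent`). For the
link part it is a Mayer–Vietoris argument: `H¹` of a shelled family vanishes
(`Shelled.exists_potential`), the triangles avoiding `v` are connected, and the star of `v` is a
cone. The witnesses are `v` and two triangles avoiding it, at most 1 + 3 + 3 = 7 vertices; this is
the bound.

Edges that are facets attach as soon as they touch what is present; two edges neither meeting nor
joined by an edge would induce a nonshellable complex on four vertices (`exists_pair_mem`). -/

theorem mem_induced {K : PreAbstractSimplicialComplex α} {U : Set α} {s : Finset α} :
    s ∈ K.induced U ↔ s ∈ K ∧ (s : Set α) ⊆ U :=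
  Iff.rfl

theorem mem_of_subset {K : PreAbstractSimplicialComplex α} {s t : Finset α} (hs : s ∈ K)
    (hts : t ⊆ s) (ht : t.Nonempty) : t ∈ K :=
  (K.isRelLowerSet_faces hs).2 hts ht

theorem nonempty_of_mem {K : PreAbstractSimplicialComplex α} {s : Finset α} (hs : s ∈ K) :
    s.Nonempty :=
  (K.isRelLowerSet_faces hs).1

theorem subset_vertices {K : PreAbstractSimplicialComplex α} {s : Finset α} (hs : s ∈ K) :
    (s : Set α) ⊆ K.vertices := fun x hx =>
  mem_of_subset hs (Finset.singleton_subset_iff.2 hx) (Finset.singleton_nonempty x)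

section

variable [DecidableEq α]

/-! ### Shellings of finite families of sets -/

/-- The face `F` may follow the faces in `R` in a shelling: every intersection of `F` with a
member of `R` is contained in an intersection that has one vertex less than `F`. -/
def CanAttach (R : Finset (Finset α)) (F : Finset α) : Prop :=
  ∀ E ∈ R, ∃ E' ∈ R, F ∩ E ⊆ E' ∧ (F ∩ E').card + 1 = F.card

/-- The members of a finite family of sets can be listed so that each may follow the earlier
ones in a shelling. -/
inductive Shelled : Finset (Finset α) → Prop
  | empty : Shelled ∅
  | attach {R : Finset (Finset α)} {F : Finset α} :
      Shelled R → F ∉ R → CanAttach R F → Shelled (insert F R)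

/-- A shelling of a subfamily can be completed when it can be extended at every stage. -/
theorem Shelled.extend {R S : Finset (Finset α)} (hR : Shelled R) (hRS : R ⊆ S)
    (h : ∀ Q, R ⊆ Q → Q ⊂ S → ∃ F ∈ S, F ∉ Q ∧ CanAttach Q F) : Shelled S := by
  have key : ∀ n, ∀ Q, Shelled Q → R ⊆ Q → Q ⊆ S → (S \ Q).card = n → Shelled S := by
    intro n
    induction n with
    | zero =>
      intro Q hQ _ hQS hc
      rw [Finset.card_eq_zero, Finset.sdiff_eq_empty_iff_subset] at hc
      rwa [Finset.Subset.antisymm hc hQS]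
    | succ n ih =>
      intro Q hQ hRQ hQS hc
      have hne : Q ⊂ S := by
        refine Finset.ssubset_iff_subset_ne.2 ⟨hQS, ?_⟩
        rintro rfl
        simp at hc
      obtain ⟨F, hFS, hFQ, hF⟩ := h Q hRQ hne
      refine ih (insert F Q) (hQ.attach hFQ hF) (hRQ.trans (Finset.subset_insert _ _))
        (Finset.insert_subset hFS hQS) ?_
      rw [Finset.sdiff_insert, Finset.card_erase_of_mem (Finset.mem_sdiff.2 ⟨hFS, hFQ⟩), hc]
      rfl
  exact key _ R hR Finset.Subset.rfl hRS rfl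

/-! ### Connectivity and first cohomology of shelled triangles -/

/-- Stars in a shelled family of triangles are strongly connected. -/
theorem Shelled.exists_adjacent {T : Finset (Finset α)} (hT : Shelled T)
    (h3 : ∀ t ∈ T, t.card = 3) (P : Finset α → Prop) (G : Finset α) :
    ∀ t ∈ T, ∀ s ∈ T, G ⊆ t → G ⊆ s → P t → ¬ P s →
      ∃ t' ∈ T, ∃ s' ∈ T, G ⊆ t' ∧ G ⊆ s' ∧ P t' ∧ ¬ P s' ∧ (t' ∩ s').card = 2 := by
  induction hT with
  | empty => simp
  | @attach R F hR hF hatt ih =>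
    have ih := ih fun t ht => h3 t (Finset.mem_insert_of_mem ht)
    have hF3 := h3 F (Finset.mem_insert_self _ _)
    intro t ht s hs hGt hGs hPt hPs
    have lift : (∃ t' ∈ R, ∃ s' ∈ R, G ⊆ t' ∧ G ⊆ s' ∧ P t' ∧ ¬ P s' ∧ (t' ∩ s').card = 2) →
        ∃ t' ∈ insert F R, ∃ s' ∈ insert F R,
          G ⊆ t' ∧ G ⊆ s' ∧ P t' ∧ ¬ P s' ∧ (t' ∩ s').card = 2 := by
      rintro ⟨t', ht', s', hs', h⟩
      exact ⟨t', Finset.mem_insert_of_mem ht', s', Finset.mem_insert_of_mem hs', h⟩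
    rcases Finset.mem_insert.1 ht with rfl | htR <;> rcases Finset.mem_insert.1 hs with rfl | hsR
    · exact absurd hPt hPs
    -- The earlier triangle `E` shares an edge with the new one and contains `G`. Either the cut
    -- separates these two, or it separates `E` from `s` among the earlier triangles.
    · obtain ⟨E, hE, hsub, hcard⟩ := hatt s hsR
      have hGE : G ⊆ E := (Finset.subset_inter hGt hGs).trans hsub
      by_cases hPE : P E
      · exact lift (ih E hE s hsR hGE hGs hPE hPs)
      · exact ⟨t, ht, E, Finset.mem_insert_of_mem hE, hGt, hGE, hPt, hPE, by omega⟩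
    · obtain ⟨E, hE, hsub, hcard⟩ := hatt t htR
      have hGE : G ⊆ E := (Finset.subset_inter hGs hGt).trans hsub
      by_cases hPE : P E
      · refine ⟨E, Finset.mem_insert_of_mem hE, s, hs, hGE, hGs, hPE, hPs, ?_⟩
        rw [Finset.inter_comm]
        omega
      · exact lift (ih t htR E hE hGt hGE hPt hPE)
    · exact lift (ih t htR s hsR hGt hGs hPt hPs)

/-- Every integral `1`-cocycle on a shelled family of triangles is a coboundary. -/
theorem Shelled.exists_potential {T : Finset (Finset α)} (hT : Shelled T)
    (h3 : ∀ t ∈ T, t.card = 3) (φ : α → α → ℤ) (hanti : ∀ a b, φ a b = -φ b a) :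
    (∀ t ∈ T, ∀ a ∈ t, ∀ b ∈ t, ∀ c ∈ t, φ a b + φ b c + φ c a = 0) →
      ∃ g : α → ℤ, ∀ t ∈ T, ∀ a ∈ t, ∀ b ∈ t, φ a b = g b - g a := by
  induction hT with
  | empty => simp
  | @attach R F hR hF hatt ih =>
    intro hφ
    obtain ⟨g, hg⟩ := ih (fun t ht => h3 t (Finset.mem_insert_of_mem ht))
      (fun t ht => hφ t (Finset.mem_insert_of_mem ht))
    have hF3 := h3 F (Finset.mem_insert_self _ _)
    have hφF := hφ F (Finset.mem_insert_self _ _)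
    -- The old part of `F` is a union of edges of `F`, any two of which meet because 2 + 2 > 3.
    -- Being connected, it lets the old potential be compared with `φ` from one base vertex `a`.
    have base : ∃ a ∈ F, ∀ E ∈ R, ∀ x ∈ F, x ∈ E → φ a x = g x - g a := by
      rcases R.eq_empty_or_nonempty with rfl | ⟨E, hE⟩
      · obtain ⟨a, ha⟩ := Finset.card_pos.1 (by omega : 0 < F.card)
        exact ⟨a, ha, by simp⟩
      · obtain ⟨E', hE', -, hc'⟩ := hatt E hE
        obtain ⟨a, ha⟩ := Finset.card_pos.1 (by omega : 0 < (F ∩ E').card)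
        rw [Finset.mem_inter] at ha
        refine ⟨a, ha.1, fun D hD x hxF hxD => ?_⟩
        obtain ⟨D', hD', hsub, hd'⟩ := hatt D hD
        have hx : x ∈ D' := hsub (Finset.mem_inter.2 ⟨hxF, hxD⟩)
        have hmeet : ((F ∩ E') ∩ (F ∩ D')).Nonempty := by
          rw [← Finset.card_pos]
          have h1 := Finset.card_union_add_card_inter (F ∩ E') (F ∩ D')
          have h2 : ((F ∩ E') ∪ (F ∩ D')).card ≤ F.card := Finset.card_le_card
            (Finset.union_subset Finset.inter_subset_left Finset.inter_subset_left)
          omega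
        obtain ⟨y, hy⟩ := hmeet
        simp only [Finset.mem_inter] at hy
        have e1 := hg D' hD' y hy.2.2 x hx
        have e2 := hg E' hE' a ha.2 y hy.1.2
        have e3 := hφF a ha.1 y hy.1.1 x hxF
        have e4 := hanti x a
        linarith
    obtain ⟨a, ha, hag⟩ := base
    classical
    refine ⟨fun x => if ∃ E ∈ R, x ∈ E then g x else g a + φ a x, fun t ht b hb c hc => ?_⟩
    rcases Finset.mem_insert.1 ht with rfl | htR
    · have val : ∀ x ∈ t, (if ∃ E ∈ R, x ∈ E then g x else g a + φ a x) = g a + φ a x := by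
        intro x hx
        split_ifs with h
        · obtain ⟨E, hE, hxE⟩ := h
          linarith [hag E hE x hx hxE]
        · rfl
      simp only [val b hb, val c hc]
      linarith [hφF a ha b hb c hc, hanti c a]
    · simp only [if_pos (⟨t, htR, hb⟩ : ∃ E ∈ R, b ∈ E), if_pos (⟨t, htR, hc⟩ : ∃ E ∈ R, c ∈ E)]
      exact hg t htR b hb c hc

/-! ### The link of a vertex inside the complex avoiding it -/

/-- The triangles of `T` at `v` whose edge opposite to `v` lies in a member of `T` that
avoids `v`. -/
def boundStar (T : Finset (Finset α)) (v : α) : Finset (Finset α) :=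
  T.filter fun t => v ∈ t ∧ ∃ s ∈ T, v ∉ s ∧ t.erase v ⊆ s

theorem mem_boundStar {T : Finset (Finset α)} {v : α} {t : Finset α} :
    t ∈ boundStar T v ↔ t ∈ T ∧ v ∈ t ∧ ∃ s ∈ T, v ∉ s ∧ t.erase v ⊆ s :=
  Finset.mem_filter

/-- The part of the link of `v` that lies in the complex of the triangles avoiding `v` is
connected if both the family of triangles and its subfamily avoiding `v` are shelled. -/
theorem Shelled.exists_adjacent_boundStar {T : Finset (Finset α)} (hT : Shelled T)
    (h3 : ∀ t ∈ T, t.card = 3) {v : α} (hv : Shelled (T.filter fun t => v ∉ t))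
    (P : Finset α → Prop) {t s : Finset α} (ht : t ∈ boundStar T v) (hs : s ∈ boundStar T v)
    (hPt : P t) (hPs : ¬ P s) :
    ∃ t' ∈ boundStar T v, ∃ s' ∈ boundStar T v, P t' ∧ ¬ P s' ∧ (t' ∩ s').card = 2 := by
  classical
  by_contra! hno
  -- a vertex other than `v` lies in triangles of one class only
  have sep : ∀ t' ∈ boundStar T v, ∀ s' ∈ boundStar T v, ∀ a, a ≠ v → a ∈ t' → a ∈ s' →
      P t' → P s' := by
    intro t' ht' s' hs' a hav hat has hPt'
    by_contra hPs'
    have hle : ({a, v} : Finset α) ⊆ t' ∩ s' := by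
      have := (mem_boundStar.1 ht').2.1
      have := (mem_boundStar.1 hs').2.1
      grind
    have h2 := Finset.card_le_card hle
    rw [Finset.card_pair hav] at h2
    have h3t := h3 t' (mem_boundStar.1 ht').1
    have h3s := h3 s' (mem_boundStar.1 hs').1
    have h4 : (t' ∩ s').card ≠ 3 := by
      intro h4
      have e1 := Finset.eq_of_subset_of_card_le (Finset.inter_subset_left (s₁ := t') (s₂ := s'))
        (by omega)
      have e2 := Finset.eq_of_subset_of_card_le (Finset.inter_subset_right (s₁ := t') (s₂ := s'))
        (by omega)
      rw [e1] at e2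
      exact hPs' (e2 ▸ hPt')
    have h5 := Finset.card_le_card (Finset.inter_subset_left (s₁ := t') (s₂ := s'))
    exact hno t' ht' s' hs' hPt' hPs' (by omega)
  let χ : α → ℤ := fun a => if a ≠ v ∧ ∃ t ∈ boundStar T v, a ∈ t ∧ P t then 1 else 0
  -- The Mayer–Vietoris connecting map applied to the indicator `χ` of one side of the cut: the
  -- coboundary of `χ` on the star of `v`, zero on the triangles avoiding `v`. The two agree on
  -- common edges, where `χ` is constant.
  let φ : α → α → ℤ := fun a b =>
    if ∃ s ∈ T, v ∉ s ∧ a ∈ s ∧ b ∈ s then 0 else χ b - χ a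
  have hanti : ∀ a b, φ a b = -φ b a := by
    intro a b
    have hiff : (∃ s ∈ T, v ∉ s ∧ a ∈ s ∧ b ∈ s) ↔ ∃ s ∈ T, v ∉ s ∧ b ∈ s ∧ a ∈ s := by
      simp only [and_comm]
    simp only [φ, hiff]
    split_ifs <;> ring
  have hχ : ∀ t ∈ boundStar T v, ∀ a ∈ t, ∀ b ∈ t, a ≠ v → b ≠ v → χ a = χ b := by
    intro t ht a ha b hb hav hbv
    simp only [χ]
    congr 1
    refine propext ⟨?_, ?_⟩
    · rintro ⟨-, s, hs, has, hP⟩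
      exact ⟨hbv, t, ht, hb, sep s hs t ht a hav has ha hP⟩
    · rintro ⟨-, s, hs, hbs, hP⟩
      exact ⟨hav, t, ht, ha, sep s hs t ht b hbv hbs hb hP⟩
  have hφstar : ∀ t ∈ T, v ∈ t → ∀ a ∈ t, ∀ b ∈ t, φ a b = χ b - χ a := by
    intro t ht hvt a ha b hb
    simp only [φ]
    split_ifs with h
    · obtain ⟨s, hs, hvs, has, hbs⟩ := h
      by_cases hab : a = b
      · simp [hab]
      · have hav : a ≠ v := fun h => hvs (h ▸ has)
        have hbv : b ≠ v := fun h => hvs (h ▸ hbs)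
        have hE : t.erase v = {a, b} := by
          symm
          apply Finset.eq_of_subset_of_card_le
          · grind
          · rw [Finset.card_erase_of_mem hvt, h3 t ht, Finset.card_pair hab]
        have htb : t ∈ boundStar T v :=
          mem_boundStar.2 ⟨ht, hvt, s, hs, hvs, by rw [hE]; grind⟩
        rw [hχ t htb a ha b hb hav hbv]
        simp
    · rfl
  have hφoff : ∀ t ∈ T, v ∉ t → ∀ a ∈ t, ∀ b ∈ t, φ a b = 0 := by
    intro t ht hvt a ha b hb
    exact if_pos ⟨t, ht, hvt, ha, hb⟩
  obtain ⟨g, hg⟩ := hT.exists_potential h3 φ hanti (by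
    intro t ht a ha b hb c hc
    by_cases hvt : v ∈ t
    · rw [hφstar t ht hvt a ha b hb, hφstar t ht hvt b hb c hc, hφstar t ht hvt c hc a ha]
      ring
    · rw [hφoff t ht hvt a ha b hb, hφoff t ht hvt b hb c hc, hφoff t ht hvt c hc a ha]
      ring)
  -- the potential is constant away from `v`
  have hconst : ∀ t ∈ T, v ∉ t → ∀ s ∈ T, v ∉ s → ∀ a ∈ t, ∀ b ∈ s, g a = g b := by
    intro t ht hvt s hs hvs a ha b hb
    have hin : ∀ t ∈ T, v ∉ t → ∀ a ∈ t, ∀ b ∈ t, g a = g b := by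
      intro t ht hvt a ha b hb
      linarith [hg t ht a ha b hb, hφoff t ht hvt a ha b hb]
    by_contra hne
    obtain ⟨t', ht', s', hs', -, -, hPt', hPs', hc⟩ := hv.exists_adjacent
      (fun t ht => h3 t (Finset.mem_filter.1 ht).1) (fun r => ∀ x ∈ r, g a = g x) ∅
      t (Finset.mem_filter.2 ⟨ht, hvt⟩) s (Finset.mem_filter.2 ⟨hs, hvs⟩)
      (Finset.empty_subset _) (Finset.empty_subset _) (fun x hx => hin t ht hvt a ha x hx)
      (fun h => hne (h b hb))
    obtain ⟨y, hy⟩ := Finset.card_pos.1 (by omega : 0 < (t' ∩ s').card)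
    rw [Finset.mem_inter] at hy
    rw [Finset.mem_filter] at hs'
    exact hPs' fun x hx => (hPt' y hy.1).trans (hin s' hs'.1 hs'.2 y hy.2 x hx)
  have pick : ∀ t ∈ boundStar T v, ∃ a ∈ t, a ≠ v ∧ ∃ s ∈ T, v ∉ s ∧ a ∈ s := by
    intro t ht
    obtain ⟨htT, hvt, s, hs, hvs, hsub⟩ := mem_boundStar.1 ht
    obtain ⟨a, ha⟩ := Finset.card_pos.1
      (by rw [Finset.card_erase_of_mem hvt, h3 t htT]; norm_num : 0 < (t.erase v).card)
    exact ⟨a, Finset.mem_of_mem_erase ha, Finset.ne_of_mem_erase ha, s, hs, hvs, hsub ha⟩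
  obtain ⟨a, hat, hav, ra, hra, hvra, hara⟩ := pick t ht
  obtain ⟨b, hbs, hbv, rb, hrb, hvrb, hbrb⟩ := pick s hs
  have hχv : χ v = 0 := if_neg fun h => h.1 rfl
  have hχa : χ a = 1 := if_pos ⟨hav, t, ht, hat, hPt⟩
  have hχb : χ b = 0 := if_neg fun ⟨_, r, hr, hbr, hPr⟩ => hPs (sep r hr s hs b hbv hbr hbs hPr)
  obtain ⟨htT, hvt, -⟩ := mem_boundStar.1 ht
  obtain ⟨hsT, hvs, -⟩ := mem_boundStar.1 hs
  have e1 := hg t htT v hvt a hat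
  have e2 := hg s hsT v hvs b hbs
  rw [hφstar t htT hvt v hvt a hat] at e1
  rw [hφstar s hsT hvs v hvs b hbs] at e2
  -- The potential takes equal values at `a` and `b`, yet exceeds `g v` by 1 at `a` and by 0 at `b`.
  have e3 := hconst ra hra hvra rb hrb hvrb a hara b hbrb
  linarith

/-! ### Connectivity from restrictions to seven vertices -/

theorem exists_adjacent_of_local {T : Finset (Finset α)} (h3 : ∀ t ∈ T, t.card = 3)
    (hloc : ∀ U : Finset α, U.card ≤ 7 → Shelled (T.filter fun t => t ⊆ U))
    (P : Finset α → Prop) (G : Finset α) {t s : Finset α} (ht : t ∈ T) (hs : s ∈ T)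
    (hGt : G ⊆ t) (hGs : G ⊆ s) (hPt : P t) (hPs : ¬ P s) :
    ∃ t' ∈ T, ∃ s' ∈ T, G ⊆ t' ∧ G ⊆ s' ∧ P t' ∧ ¬ P s' ∧ (t' ∩ s').card = 2 := by
  have hU : (t ∪ s).card ≤ 7 := by
    have := Finset.card_union_le t s
    have := h3 t ht
    have := h3 s hs
    omega
  obtain ⟨t', ht', s', hs', h⟩ := (hloc _ hU).exists_adjacent
    (fun t ht => h3 t (Finset.mem_filter.1 ht).1) P G
    t (Finset.mem_filter.2 ⟨ht, Finset.subset_union_left⟩)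
    s (Finset.mem_filter.2 ⟨hs, Finset.subset_union_right⟩) hGt hGs hPt hPs
  exact ⟨t', (Finset.mem_filter.1 ht').1, s', (Finset.mem_filter.1 hs').1, h⟩

/-- Two triangles `p`, `q` avoiding `v` and containing the opposite edges certify membership in
`boundStar`. Inside `{v} ∪ p ∪ q`, which has at most seven vertices, the certificates survive, and
deleting `v` again leaves a shelled restriction. -/
theorem exists_adjacent_boundStar_of_local {T : Finset (Finset α)} (h3 : ∀ t ∈ T, t.card = 3)
    (hloc : ∀ U : Finset α, U.card ≤ 7 → Shelled (T.filter fun t => t ⊆ U)) {v : α}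
    (P : Finset α → Prop) {t s : Finset α} (ht : t ∈ boundStar T v) (hs : s ∈ boundStar T v)
    (hPt : P t) (hPs : ¬ P s) :
    ∃ t' ∈ boundStar T v, ∃ s' ∈ boundStar T v, P t' ∧ ¬ P s' ∧ (t' ∩ s').card = 2 := by
  obtain ⟨htT, hvt, p, hp, hvp, htp⟩ := mem_boundStar.1 ht
  obtain ⟨hsT, hvs, q, hq, hvq, hsq⟩ := mem_boundStar.1 hs
  have hU : (insert v (p ∪ q)).card ≤ 7 := by
    have := Finset.card_insert_le v (p ∪ q)
    have := Finset.card_union_le p q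
    have := h3 p hp
    have := h3 q hq
    omega
  have hU' : (p ∪ q).card ≤ 7 := (Finset.card_le_card (Finset.subset_insert _ _)).trans hU
  have hoff : ((T.filter fun t => t ⊆ insert v (p ∪ q)).filter fun t => v ∉ t) =
      T.filter fun t => t ⊆ p ∪ q := by
    ext r
    simp only [Finset.mem_filter, and_assoc]
    refine and_congr_right fun _ => ⟨fun h => (Finset.subset_insert_iff_of_notMem h.2).1 h.1,
      fun h => ⟨h.trans (Finset.subset_insert _ _), fun hvr => ?_⟩⟩
    exact (Finset.mem_union.1 (h hvr)).elim hvp hvq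
  have hpU : p ⊆ insert v (p ∪ q) :=
    Finset.subset_union_left.trans (Finset.subset_insert _ _)
  have hqU : q ⊆ insert v (p ∪ q) :=
    Finset.subset_union_right.trans (Finset.subset_insert _ _)
  have htU : t ⊆ insert v (p ∪ q) :=
    Finset.subset_insert_iff.2 (htp.trans Finset.subset_union_left)
  have hsU : s ⊆ insert v (p ∪ q) :=
    Finset.subset_insert_iff.2 (hsq.trans Finset.subset_union_right)
  obtain ⟨t', ht', s', hs', h⟩ := (hloc _ hU).exists_adjacent_boundStar
    (fun t ht => h3 t (Finset.mem_filter.1 ht).1) (v := v) (hoff ▸ hloc _ hU') P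
    (mem_boundStar.2 ⟨Finset.mem_filter.2 ⟨htT, htU⟩, hvt, p,
      Finset.mem_filter.2 ⟨hp, hpU⟩, hvp, htp⟩)
    (mem_boundStar.2 ⟨Finset.mem_filter.2 ⟨hsT, hsU⟩, hvs, q,
      Finset.mem_filter.2 ⟨hq, hqU⟩, hvq, hsq⟩) hPt hPs
  have mono : ∀ r ∈ boundStar (T.filter fun t => t ⊆ insert v (p ∪ q)) v,
      r ∈ boundStar T v := by
    intro r hr
    obtain ⟨hrT, hvr, w, hw, h⟩ := mem_boundStar.1 hr
    exact mem_boundStar.2 ⟨(Finset.mem_filter.1 hrT).1, hvr, w, (Finset.mem_filter.1 hw).1, h⟩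
  exact ⟨t', mono t' ht', s', mono s' hs', h⟩

theorem mem_boundStar_of_card_inter {T : Finset (Finset α)} (h3 : ∀ t ∈ T, t.card = 3) {v : α}
    {t s : Finset α} (ht : t ∈ T) (hvt : v ∈ t) (hs : s ∈ T) (hvs : v ∉ s)
    (hc : (t ∩ s).card = 2) : t ∈ boundStar T v := by
  have hsub : t ∩ s ⊆ t.erase v := by grind
  have := Finset.eq_of_subset_of_card_le hsub
    (by rw [Finset.card_erase_of_mem hvt, h3 t ht, hc])
  exact mem_boundStar.2 ⟨ht, hvt, s, hs, hvs, this ▸ Finset.inter_subset_right⟩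

theorem card_inter_le_two {T : Finset (Finset α)} (h3 : ∀ t ∈ T, t.card = 3)
    {t E : Finset α} (ht : t ∈ T) (hE : E ∈ T) (hEt : E ≠ t) : (t ∩ E).card ≤ 2 := by
  by_contra! hc
  have h1 := h3 t ht
  have h2 := h3 E hE
  have e1 := Finset.eq_of_subset_of_card_le (Finset.inter_subset_left (s₁ := t) (s₂ := E))
    (by omega)
  have e2 := Finset.eq_of_subset_of_card_le (Finset.inter_subset_right (s₁ := t) (s₂ := E))
    (by omega)
  exact hEt (e2.symm.trans e1)

/-! ### Attaching the triangles at a vertex -/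

/-- The triangles of `boundStar T v` can be attached to those avoiding `v`. -/
theorem shelled_union_boundStar {T : Finset (Finset α)} (h3 : ∀ t ∈ T, t.card = 3)
    (hloc : ∀ U : Finset α, U.card ≤ 7 → Shelled (T.filter fun t => t ⊆ U)) {v : α}
    (hv : Shelled (T.filter fun t => v ∉ t)) :
    Shelled ((T.filter fun t => v ∉ t) ∪ boundStar T v) := by
  refine hv.extend Finset.subset_union_left fun Q hQ₀ hQ => ?_
  have hQT : ∀ E ∈ Q, E ∈ T := fun E hE => by
    rcases Finset.mem_union.1 (hQ.1 hE) with h | h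
    · exact (Finset.mem_filter.1 h).1
    · exact (mem_boundStar.1 h).1
  obtain ⟨F, hF, hFQ⟩ := Finset.exists_of_ssubset hQ
  have hFB : F ∈ boundStar T v := by
    rcases Finset.mem_union.1 hF with h | h
    · exact absurd (hQ₀ h) hFQ
    · exact h
  -- The opposite edge of `F` is always present; the only danger is that `F` meets earlier triangles
  -- at `v` in `v` alone. Once `v` has been used, connectivity of `boundStar` supplies an `F`
  -- sharing an edge through `v` with a member of `Q`.
  have key : ∃ F ∈ boundStar T v, F ∉ Q ∧
      ((∃ E ∈ Q, v ∈ E) → ∃ E ∈ Q, v ∈ E ∧ (F ∩ E).card = 2) := by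
    by_cases hE : ∃ E ∈ Q, v ∈ E
    · obtain ⟨E, hE, hvE⟩ := hE
      have hEB : E ∈ boundStar T v := by
        rcases Finset.mem_union.1 (hQ.1 hE) with h | h
        · exact absurd hvE (Finset.mem_filter.1 h).2
        · exact h
      obtain ⟨t, ht, s, hs, htQ, hsQ, hc⟩ :=
        exists_adjacent_boundStar_of_local h3 hloc (fun r => r ∉ Q) hFB hEB hFQ (fun h => h hE)
      exact ⟨t, ht, htQ, fun _ => ⟨s, not_not.1 hsQ, (mem_boundStar.1 hs).2.1, hc⟩⟩
    · exact ⟨F, hFB, hFQ, fun h => absurd h hE⟩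
  obtain ⟨F, hFB, hFQ, htouch⟩ := key
  obtain ⟨hFT, hvF, s, hs, hvs, hFs⟩ := mem_boundStar.1 hFB
  have hF3 := h3 F hFT
  have hsQ : s ∈ Q := hQ₀ (Finset.mem_filter.2 ⟨hs, hvs⟩)
  have hFs2 : (F ∩ s).card = 2 := by
    have : F ∩ s = F.erase v := by grind
    rw [this, Finset.card_erase_of_mem hvF, hF3]
  refine ⟨F, Finset.mem_union_right _ hFB, hFQ, fun E hE => ?_⟩
  by_cases hvE : v ∈ E
  · by_cases h2 : (F ∩ E).card = 2
    · exact ⟨E, hE, Finset.inter_subset_right, by omega⟩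
    · have := card_inter_le_two h3 hFT (hQT E hE) (fun h => hFQ (h ▸ hE))
      have h1 : F ∩ E = {v} := by
        symm
        apply Finset.eq_of_subset_of_card_le
        · grind
        · rw [Finset.card_singleton]
          omega
      obtain ⟨E', hE', hvE', hc⟩ := htouch ⟨E, hE, hvE⟩
      exact ⟨E', hE', by simpa [h1] using hvE', by omega⟩
  · refine ⟨s, hsQ, fun x hx => hFs ?_, by omega⟩
    rw [Finset.mem_inter] at hx
    exact Finset.mem_erase.2 ⟨fun h => hvE (h ▸ hx.2), hx.1⟩

/-- A family of triangles is shelled if its restrictions to at most seven vertices are, and its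
restriction to the complement of a single vertex is, provided that some triangle avoids that
vertex. -/
theorem shelled_of_local {T : Finset (Finset α)} (h3 : ∀ t ∈ T, t.card = 3)
    (hloc : ∀ U : Finset α, U.card ≤ 7 → Shelled (T.filter fun t => t ⊆ U)) {v : α}
    (hv : Shelled (T.filter fun t => v ∉ t)) (hne : ∃ t ∈ T, v ∉ t) : Shelled T := by
  refine (shelled_union_boundStar h3 hloc hv).extend (Finset.union_subset (Finset.filter_subset _ _)
    (Finset.filter_subset _ _)) fun Q hQ₀ hQ => ?_
  have hQ₁ : ∀ t ∈ T, v ∉ t → t ∈ Q := fun t ht hvt =>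
    hQ₀ (Finset.mem_union_left _ (Finset.mem_filter.2 ⟨ht, hvt⟩))
  have hQ₂ : ∀ t ∈ boundStar T v, t ∈ Q := fun t ht => hQ₀ (Finset.mem_union_right _ ht)
  obtain ⟨F, hFT, hFQ⟩ := Finset.exists_of_ssubset hQ
  have hvF : v ∈ F := by
    by_contra h
    exact hFQ (hQ₁ F hFT h)
  obtain ⟨s, hs, hvs⟩ := hne
  obtain ⟨t, ht, r, hr, -, -, hvt, hvr, hc⟩ := exists_adjacent_of_local h3 hloc
    (fun r => v ∈ r) ∅ hFT hs
    (Finset.empty_subset _) (Finset.empty_subset _) hvF hvs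
  have htB := mem_boundStar_of_card_inter h3 ht hvt hr hvr hc
  -- Since `boundStar` is nonempty and contained in `Q`, strong connectivity of the star of `v`
  -- gives a missing `F` sharing an edge through `v` with some `D` in `Q`.
  obtain ⟨F, hFT, D, hDT, hvF, hvD, hFQ, hDQ, hFD⟩ := exists_adjacent_of_local h3 hloc
    (fun r => r ∉ Q) {v} hFT ht
    (by simpa using hvF) (by simpa using hvt) hFQ (fun h => h (hQ₂ t htB))
  rw [Finset.singleton_subset_iff] at hvF hvD
  rw [not_not] at hDQ
  have hF3 := h3 F hFT
  refine ⟨F, hFT, hFQ, fun E hE => ?_⟩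
  have hEF : E ≠ F := fun h => hFQ (h ▸ hE)
  have hle := card_inter_le_two h3 hFT (hQ.1 hE) hEF
  by_cases h2 : (F ∩ E).card = 2
  · exact ⟨E, hE, Finset.inter_subset_right, by omega⟩
  by_cases h0 : (F ∩ E) ⊆ D
  · exact ⟨D, hDQ, h0, by omega⟩
  obtain ⟨a, ha, haD⟩ := Finset.not_subset.1 h0
  have h1 : F ∩ E = {a} := by
    symm
    apply Finset.eq_of_subset_of_card_le
    · simpa using ha
    · rw [Finset.card_singleton]
      omega
  rw [Finset.mem_inter] at ha
  have hvE : v ∉ E := by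
    intro hvE
    have : v ∈ F ∩ E := Finset.mem_inter.2 ⟨hvF, hvE⟩
    rw [h1, Finset.mem_singleton] at this
    exact haD (this ▸ hvD)
  -- The remaining bad case is an intersection `{a}` with `a` outside `D`. In the star of `a`, some
  -- triangle `p` through `v` shares an edge with one avoiding `v`. So `p` lies in `boundStar`, is
  -- already in `Q`, and meets `F` in the edge `av`.
  obtain ⟨p, hp, q, hq, hap, haq, hvp, hvq, hpq⟩ := exists_adjacent_of_local h3 hloc
    (fun r => v ∈ r) {a} hFT (hQ.1 hE)
    (by simpa using ha.1) (by simpa using ha.2) hvF hvE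
  rw [Finset.singleton_subset_iff] at hap
  have hpB := mem_boundStar_of_card_inter h3 hp hvp hq hvq hpq
  refine ⟨p, hQ₂ p hpB, by simpa [h1] using hap, ?_⟩
  have hav : a ≠ v := fun h => haD (h ▸ hvD)
  have hsub : ({a, v} : Finset α) ⊆ F ∩ p := by grind
  have hge := Finset.card_le_card hsub
  rw [Finset.card_pair hav] at hge
  have := card_inter_le_two h3 hFT hp (fun h => hFQ (h ▸ hQ₂ p hpB))
  omega

/-! ### Shelled families and shellable complexes -/

theorem IsShelling.exists_inter {K : PreAbstractSimplicialComplex α} {l : List (Finset α)}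
    (h : K.IsShelling l) {l₁ l₂ : List (Finset α)} {F : Finset α} (hl : l = l₁ ++ F :: l₂)
    {E : Finset α} (hE : E ∈ l₁) :
    ∃ E' ∈ l₁, F ∩ E ⊆ E' ∧ (F ∩ E').card + 1 = F.card := by
  have hfin : (previousFaces l₁ F).Finite :=
    F.powerset.finite_toSet.subset fun G hG => by simpa using hG.1
  obtain ⟨G, hG, hmax⟩ := hfin.exists_le_maximal
    (show F ∩ E ∈ previousFaces l₁ F from ⟨Finset.inter_subset_left, E, hE,
      Finset.inter_subset_right⟩)
  have hcard := h.2.2 l₁ F l₂ hl (List.ne_nil_of_mem hE) G hmax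
  obtain ⟨hGF, E', hE', hGE⟩ := hmax.1
  have hsub : G ⊆ F ∩ E' := Finset.subset_inter hGF hGE
  have heq : F ∩ E' = G := Finset.Subset.antisymm
    (hmax.2 (show F ∩ E' ∈ previousFaces l₁ F from ⟨Finset.inter_subset_left, E', hE',
      Finset.inter_subset_right⟩) hsub) hsub
  exact ⟨E', hE', hG.trans hGE, heq ▸ hcard⟩

/-- The faces of maximal cardinality of a shellable complex form a shelled family. -/
theorem Shellable.shelled_filter {K : PreAbstractSimplicialComplex α} (hK : K.Shellable)
    {d : ℕ} (hd : ∀ s ∈ K, s.card ≤ d + 2) {T : Finset (Finset α)}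
    (hT : ∀ t, t ∈ T ↔ t ∈ K ∧ t.card = d + 2) : Shelled T := by
  obtain ⟨l, hl⟩ := hK
  have key : ∀ l₁ l₂, l = l₁ ++ l₂ → Shelled (l₁.toFinset.filter fun t => t.card = d + 2) := by
    intro l₁
    induction l₁ using List.reverseRecOn with
    | nil =>
      intro _ _
      simpa using Shelled.empty
    | append_singleton l₁ F ih =>
      intro l₂ hl₂
      have hl₂' : l = l₁ ++ F :: l₂ := by simpa using hl₂
      have ih := ih _ hl₂'
      have hins : (l₁ ++ [F]).toFinset = insert F l₁.toFinset := by
        ext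
        simp
      rw [hins, Finset.filter_insert]
      split_ifs with hF
      · refine ih.attach ?_ fun E hE => ?_
        · have := hl.1
          rw [hl₂', List.nodup_append] at this
          simp only [Finset.mem_filter, List.mem_toFinset, not_and]
          intro hmem
          exact absurd rfl (this.2.2 F hmem F List.mem_cons_self)
        · rw [Finset.mem_filter, List.mem_toFinset] at hE
          obtain ⟨E', hE', hsub, hc⟩ := hl.exists_inter hl₂' hE.1
          have hFK : K.IsFacet F := (hl.2.1 F).1 (by simp [hl₂'])
          have hEK : K.IsFacet E' := (hl.2.1 E').1 (by simp [hl₂', hE'])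
          refine ⟨E', ?_, hsub, hc⟩
          rw [Finset.mem_filter, List.mem_toFinset]
          refine ⟨hE', ?_⟩
          -- A smaller `E'` would have no vertex outside `F ∩ E'`, hence lie inside `F`,
          -- contradicting that it is a facet.
          by_contra hne
          have hle := hd E' hEK.1
          have heq := Finset.eq_of_subset_of_card_le
            (Finset.inter_subset_right (s₁ := F) (s₂ := E')) (by omega)
          have hEF : E' ⊆ F := heq ▸ Finset.inter_subset_left
          have hFE : F ⊆ E' := hEK.2 hFK.1 hEF
          rw [Finset.Subset.antisymm hEF hFE] at hne
          exact hne hF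
      · exact ih
  convert key l [] (by simp) using 1
  ext t
  rw [hT, Finset.mem_filter, List.mem_toFinset, hl.2.1]
  refine and_congr_left fun ht => ⟨fun h => ⟨h, fun s hs hts => ?_⟩, fun h => h.1⟩
  exact (Finset.eq_of_subset_of_card_le hts (by rw [ht]; exact hd s hs)).ge

theorem Shelled.exists_list {S : Finset (Finset α)} (hS : Shelled S) :
    ∃ l : List (Finset α), l.Nodup ∧ (∀ F, F ∈ l ↔ F ∈ S) ∧
      ∀ (l₁ : List (Finset α)) (F : Finset α) (l₂ : List (Finset α)), l = l₁ ++ F :: l₂ →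
        ∀ E ∈ l₁, ∃ E' ∈ l₁, F ∩ E ⊆ E' ∧ (F ∩ E').card + 1 = F.card := by
  induction hS with
  | empty => exact ⟨[], by simp⟩
  | @attach R F hR hF hatt ih =>
    obtain ⟨l, hnd, hmem, hl⟩ := ih
    refine ⟨l ++ [F], ?_, ?_, ?_⟩
    · rw [← List.concat_eq_append, List.nodup_concat]
      exact ⟨fun h => hF ((hmem F).1 h), hnd⟩
    · intro G
      simp [hmem, or_comm]
    · intro l₁ G l₂ heq
      rcases List.eq_nil_or_concat l₂ with rfl | ⟨l₃, H, rfl⟩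
      · obtain ⟨rfl, h⟩ := List.append_inj' heq rfl
        obtain rfl : F = G := by simpa using h
        intro E hE
        obtain ⟨E', hE', h⟩ := hatt E ((hmem E).1 hE)
        exact ⟨E', (hmem E').2 hE', h⟩
      · refine hl l₁ G l₃ ?_
        rw [List.concat_eq_append, ← List.cons_append, ← List.append_assoc] at heq
        exact (List.append_inj' heq rfl).1

theorem Shelled.shellable {K : PreAbstractSimplicialComplex α} {S : Finset (Finset α)}
    (hS : Shelled S) (hfacet : ∀ F, F ∈ S ↔ K.IsFacet F) : K.Shellable := by
  obtain ⟨l, hnd, hmem, hl⟩ := hS.exists_list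
  refine ⟨l, hnd, fun F => (hmem F).trans (hfacet F), fun l₁ F l₂ heq _ G hG => ?_⟩
  obtain ⟨hGF, E, hE, hGE⟩ := hG.1
  obtain ⟨E', hE', hsub, hc⟩ := hl l₁ F l₂ heq E hE
  have h1 : G ⊆ F ∩ E' := Finset.subset_inter hGF ((Finset.subset_inter hGF hGE).trans hsub)
  have h2 : F ∩ E' ⊆ G := hG.2 (show F ∩ E' ∈ previousFaces l₁ F from
    ⟨Finset.inter_subset_left, E', hE', Finset.inter_subset_right⟩) h1
  rw [Finset.Subset.antisymm h1 h2, hc]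

/-! ### Facets of dimension at most one -/

/-- Two edges spanning a shellable induced subcomplex are joined by an edge or meet. -/
theorem exists_pair_mem {K : PreAbstractSimplicialComplex α} {e f : Finset α} (he : e ∈ K)
    (hf : f ∈ K) (hec : e.card = 2) (hfc : f.card = 2)
    (hsh : (K.induced ((e : Set α) ∪ f)).Shellable) :
    ∃ p ∈ e, ∃ q ∈ f, ({p, q} : Finset α) ∈ K := by
  by_contra! hno
  obtain ⟨l, hl⟩ := hsh
  have side : ∀ s ∈ K.induced ((e : Set α) ∪ f), s ⊆ e ∨ s ⊆ f := by
    intro s hs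
    by_contra! hs'
    obtain ⟨hse, hsf⟩ := hs'
    obtain ⟨q, hqs, hqe⟩ := Finset.not_subset.1 hse
    obtain ⟨p, hps, hpf⟩ := Finset.not_subset.1 hsf
    have hq : q ∈ f := by simpa [hqe] using hs.2 hqs
    have hp : p ∈ e := by simpa [hpf] using hs.2 hps
    exact hno p hp q hq (mem_of_subset hs.1 (by grind) ⟨p, by simp⟩)
  have disj : ∀ x ∈ e, x ∉ f := by
    intro x hx hxf
    refine hno x hx x hxf (mem_of_subset he (by simpa using hx) (by simp))
  have hfacet : ∀ g, (g = e ∨ g = f) ↔ (K.induced ((e : Set α) ∪ f)).IsFacet g := by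
    have hmem : e ∈ K.induced ((e : Set α) ∪ f) ∧ f ∈ K.induced ((e : Set α) ∪ f) :=
      ⟨⟨he, Set.subset_union_left⟩, ⟨hf, Set.subset_union_right⟩⟩
    obtain ⟨x, hx⟩ := nonempty_of_mem he
    obtain ⟨y, hy⟩ := nonempty_of_mem hf
    intro g
    constructor
    · rintro (rfl | rfl)
      · refine ⟨hmem.1, fun s hs hgs => (side s hs).resolve_right fun h => ?_⟩
        exact disj x hx (h (hgs hx))
      · refine ⟨hmem.2, fun s hs hgs => (side s hs).resolve_left fun h => ?_⟩
        exact disj y (h (hgs hy)) hy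
    · intro hg
      rcases side g hg.1 with h | h
      · exact Or.inl (Finset.Subset.antisymm h (hg.2 hmem.1 h))
      · exact Or.inr (Finset.Subset.antisymm h (hg.2 hmem.2 h))
  have hmem : ∀ g, g ∈ l ↔ g = e ∨ g = f := fun g => (hl.2.1 g).trans (hfacet g).symm
  have hef : Disjoint e f := Finset.disjoint_left.2 disj
  obtain ⟨l₁, l₂, heq⟩ := List.append_of_mem ((hmem e).2 (Or.inl rfl))
  have hnd := hl.1
  rw [heq, List.nodup_append, List.nodup_cons] at hnd
  -- The only facets are the disjoint edges `e` and `f`, so whichever comes second meets the first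
  -- in the empty face, which has too few vertices.
  by_cases hf₁ : f ∈ l₁
  · obtain ⟨E', hE', -, hc⟩ := hl.exists_inter heq hf₁
    rcases (hmem E').1 (by simp [heq, hE']) with rfl | rfl
    · exact hnd.2.2 _ hE' _ List.mem_cons_self rfl
    · rw [Finset.disjoint_iff_inter_eq_empty.1 hef, Finset.card_empty] at hc
      omega
  · have hfe : f ≠ e := by
      rintro rfl
      rw [disjoint_self] at hef
      simp [hef] at hfc
    have hf₂ : f ∈ l₂ := by
      have := (hmem f).2 (Or.inr rfl)
      simpa [heq, hf₁, hfe] using this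
    obtain ⟨m₁, m₂, rfl⟩ := List.append_of_mem hf₂
    obtain ⟨E', hE', -, hc⟩ := hl.exists_inter (l₁ := l₁ ++ e :: m₁) (F := f) (l₂ := m₂)
      (by simp [heq]) (E := e) (by simp)
    have hnd' := hl.1
    rw [show l = (l₁ ++ e :: m₁) ++ f :: m₂ by simp [heq], List.nodup_append] at hnd'
    rcases (hmem E').1 (by rw [heq]; grind) with rfl | rfl
    · rw [Finset.disjoint_iff_inter_eq_empty.1 hef.symm, Finset.card_empty] at hc
      omega
    · exact hnd'.2.2 _ hE' _ List.mem_cons_self rfl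

/-- A two-dimensional complex is shellable if its triangles form a shelled family and any two
of its edges meet or are joined by an edge. -/
theorem shellable_of_shelled_triangles {K : PreAbstractSimplicialComplex α}
    (hfin : K.faces.Finite) (hdim : K.HasDimension 2) {T : Finset (Finset α)}
    (hT : ∀ t, t ∈ T ↔ t ∈ K ∧ t.card = 3) (hsh : Shelled T)
    (hpair : ∀ e ∈ K, ∀ f ∈ K, e.card = 2 → f.card = 2 →
      ∃ p ∈ e, ∃ q ∈ f, ({p, q} : Finset α) ∈ K) : K.Shellable := by
  classical
  obtain ⟨S, hS⟩ : ∃ S : Finset (Finset α), ∀ F, F ∈ S ↔ K.IsFacet F :=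
    ⟨hfin.toFinset.filter fun F => K.IsFacet F, fun F => by
      rw [Finset.mem_filter, Set.Finite.mem_toFinset]
      exact ⟨fun h => h.2, fun h => ⟨h.1, h⟩⟩⟩
  have hTS : T ⊆ S := fun t ht => (hS t).2 ⟨((hT t).1 ht).1, fun s hs hts =>
    (Finset.eq_of_subset_of_card_le hts (by rw [((hT t).1 ht).2]; exact hdim.2 s hs)).ge⟩
  refine (hsh.extend hTS fun Q hTQ hQ => ?_).shellable hS
  have hinter : ∀ F ∈ S, F ∉ Q → ∀ E ∈ Q, (F ∩ E).card < F.card := by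
    intro F hF hFQ E hE
    refine Finset.card_lt_card ⟨Finset.inter_subset_left, fun h => hFQ ?_⟩
    have hFE : F ⊆ E := h.trans Finset.inter_subset_right
    have hEK : E ∈ K := ((hS E).1 (hQ.1 hE)).1
    rwa [Finset.Subset.antisymm hFE (((hS F).1 hF).2 hEK hFE)]
  have htouch : ∀ F ∈ S, F ∉ Q → F.card = 2 → (∃ E ∈ Q, (F ∩ E).Nonempty) →
      CanAttach Q F := by
    rintro F hF hFQ hF2 ⟨D, hD, hFD⟩ E hE
    have h1 := hinter F hF hFQ E hE
    have h2 := hinter F hF hFQ D hD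
    rw [← Finset.card_pos] at hFD
    rcases Nat.eq_zero_or_pos (F ∩ E).card with h | h
    · rw [Finset.card_eq_zero] at h
      exact ⟨D, hD, by simp [h], by omega⟩
    · exact ⟨E, hE, Finset.inter_subset_right, by omega⟩
  obtain ⟨F, hFS, hFQ⟩ := Finset.exists_of_ssubset hQ
  have hFK : F ∈ K := ((hS F).1 hFS).1
  have hF0 := Finset.card_pos.2 (nonempty_of_mem hFK)
  have hF2 : F.card ≤ 2 := by
    have h1 := hdim.2 F hFK
    have h2 : F.card ≠ 3 := fun h => hFQ (hTQ ((hT F).2 ⟨hFK, h⟩))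
    omega
  rcases (by omega : F.card = 1 ∨ F.card = 2) with hc | hc
  -- An isolated vertex attaches at any time: it meets earlier facets in the empty face, of the
  -- required size 0.
  · refine ⟨F, hFS, hFQ, fun E hE => ⟨E, hE, Finset.inter_subset_right, ?_⟩⟩
    have := hinter F hFS hFQ E hE
    omega
  by_cases hmeet : ∃ E ∈ Q, (F ∩ E).Nonempty
  · exact ⟨F, hFS, hFQ, htouch F hFS hFQ hc hmeet⟩
  -- If the edge `F` misses everything in `Q`, attach another facet instead: one containing an edge
  -- that joins `F` to a triangle. It meets `F`, so it is not in `Q`, hence is no triangle, and it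
  -- touches the triangle.
  obtain ⟨t, htK, ht3⟩ := hdim.1
  obtain ⟨f, hft, hf2⟩ := Finset.exists_subset_card_eq (by omega : 2 ≤ t.card)
  obtain ⟨p, hp, q, hq, hpq⟩ := hpair F hFK f
    (mem_of_subset htK hft (Finset.card_pos.1 (by omega))) hc hf2
  obtain ⟨E, hE, hEmax⟩ := hfin.exists_le_maximal hpq
  have hES : E ∈ S := (hS E).2 hEmax
  have hpE : p ∈ E := hE (by simp)
  have hqE : q ∈ E := hE (by simp)
  have hEQ : E ∉ Q := fun h => hmeet ⟨E, h, p, Finset.mem_inter.2 ⟨hp, hpE⟩⟩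
  have htQ : t ∈ Q := hTQ ((hT t).2 ⟨htK, ht3⟩)
  have hpne : p ≠ q := by
    rintro rfl
    exact hmeet ⟨t, htQ, p, Finset.mem_inter.2 ⟨hp, hft hq⟩⟩
  have hE2 : E.card = 2 := by
    have h1 := hdim.2 E hEmax.1
    have h2 : E.card ≠ 3 := fun h => hEQ (hTQ ((hT E).2 ⟨hEmax.1, h⟩))
    have h3 := Finset.card_le_card hE
    rw [Finset.card_pair hpne] at h3
    omega
  exact ⟨E, hES, hEQ, htouch E hES hEQ hE2 ⟨t, htQ, q, Finset.mem_inter.2 ⟨hqE, hft hq⟩⟩⟩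

end

/-! ### Complexes with more than seven vertices -/

theorem not_isObstruction_of_seven_lt_ncard (K : PreAbstractSimplicialComplex α)
    (hfin : K.faces.Finite) (hdim : K.HasDimension 2) (hcard : 7 < K.vertices.ncard) :
    ¬ K.IsObstruction := by
  classical
  rintro ⟨hns, hind⟩
  obtain ⟨T, hT⟩ : ∃ T : Finset (Finset α), ∀ t, t ∈ T ↔ t ∈ K ∧ t.card = 3 :=
    ⟨hfin.toFinset.filter fun t => t.card = 3, fun t => by
      rw [Finset.mem_filter, Set.Finite.mem_toFinset]
      rfl⟩
  have hsub : ∀ U : Set α, U ⊂ K.vertices → ∀ S : Finset (Finset α),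
      (∀ t, t ∈ S ↔ t ∈ T ∧ (t : Set α) ⊆ U) → Shelled S := by
    intro U hU S hS
    -- The bound 3 on face sizes holds even if the induced subcomplex has lower dimension; the
    -- family of triangles is then empty.
    refine (hind U hU).shelled_filter (d := 1) (fun s hs => hdim.2 s hs.1) fun t => ?_
    rw [hS, hT, mem_induced]
    tauto
  have hproper : ∀ U : Finset α, U.card ≤ 7 → (U : Set α) ∩ K.vertices ⊂ K.vertices := by
    intro U hU
    refine Set.ssubset_iff_subset_ne.2 ⟨Set.inter_subset_right, fun h => ?_⟩
    have h1 := Set.ncard_le_ncard (Set.inter_eq_right.1 h) U.finite_toSet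
    rw [Set.ncard_coe_finset] at h1
    omega
  refine hns (shellable_of_shelled_triangles hfin hdim hT ?_ ?_)
  · obtain ⟨t, htK, ht3⟩ := hdim.1
    obtain ⟨v, hv, hvt⟩ := Set.exists_of_ssubset (hproper t (by omega))
    have hvt : v ∉ t := fun h => hvt ⟨h, hv⟩
    refine shelled_of_local (v := v) (fun t ht => ((hT t).1 ht).2) (fun U hU => ?_) ?_
      ⟨t, (hT t).2 ⟨htK, ht3⟩, hvt⟩
    · refine hsub _ (hproper U hU) _ fun t => ?_
      rw [Finset.mem_filter]
      refine and_congr_right fun ht => ?_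
      rw [Set.subset_inter_iff, Finset.coe_subset]
      exact (and_iff_left (subset_vertices ((hT t).1 ht).1)).symm
    · refine hsub (K.vertices \ {v}) (Set.sdiff_singleton_ssubset.2 hv) _ fun t => ?_
      rw [Finset.mem_filter]
      refine and_congr_right fun ht => ?_
      exact ⟨fun h => Set.subset_sdiff_singleton (subset_vertices ((hT t).1 ht).1) h,
        fun h hvt => (h hvt).2 rfl⟩
  · intro e he f hf hec hfc
    refine exists_pair_mem he hf hec hfc (hind _ ?_)
    have hU : (e ∪ f).card ≤ 7 := by
      have := Finset.card_union_le e f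
      omega
    have h := hproper _ hU
    rwa [Set.inter_eq_left.2, Finset.coe_union] at h
    rw [Finset.coe_union]
    exact Set.union_subset (subset_vertices he) (subset_vertices hf)

end PreAbstractSimplicialComplex

theorem theorem3 {α : Type*} (K : PreAbstractSimplicialComplex α) (hfin : K.faces.Finite)
    (hdim : K.HasDimension 2) (hcard : 7 < K.vertices.ncard) :
    ¬ K.IsObstruction :=
  K.not_isObstruction_of_seven_lt_ncard hfin hdim hcard
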